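/- **Setting.** Let $D\subset\mathbb R^d$ be open and connected and let $$Au(x)=\tfrac12\mathrm{Tr}(\mathbf Q(x)\nabla^2u(x))+b(x)\cdot\nabla u(x)+\int_{\mathbb R^d}\Big(u(x+y)-u(x)-\frac{y\cdot\nabla u(x)}{1+|y|^2}\Big)N(x,dy),$$ where $\mathbf Q,b$ are Borel measurable on $\mathbb R^d$ and bounded on $D$, $\mathbf Q(x)$ is non-negative definite for $x\in D$, and $N$ is a Lévy kernel (a measurable family of Borel measures $N(x,\cdot)$ on $\mathbb R^d\setminus\{0\}$) with $\sup_{x\in\mathbb R^d}\int\min\{1,|y|^2\}N(x,dy)<\infty$. Let $c:D\to[0,\infty)$ be bounded and Borel and $g:D\to(-\infty,0]$ Borel. Assume that $(P_x)_{x\in\mathbb R^d}$, with expectations $\mathbb E_x$, is a strong Markovian solution, on càdlàg paths in $\mathbb R^d$ with canonical process $(X_t)$, of the martingale problem for $A$: under $P_x$ the process starts at $x$ and $f(X_t)-f(X_0)-\int_0^tAf(X_r)\,dr$ is a martingale (with an a.s. absolutely convergent time integral) for the natural filtration, for every $f\in C^2_b(\mathbb R^d)$; $x\mapsto P_x$ is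 measurable; $(X_t)$ is strong Markov for its natural filtration; and for every Borel probability measure $\mu$ on $\mathbb R^d$ the mixture $\int P_x\,\mu(dx)$ solves the martingale problem with initial law $\mu$. Let $\tau_D=\inf\{t>0:X_t\notin D\}$ and assume $P_x(\tau_D<\infty)=1$ for all $x\in D$. Put $\mathcal S(D)=\bigcup_{x\in D}\big(x+\mathrm{supp}\,N(x,\cdot)\big)$ and $D_S=D\cup\partial D\cup\mathcal S(D)$; write $\bar f_B=\sup_Bf$, $\underline f_B=\inf_Bf$, $g^-=\max\{-g,0\}$ and $e_c(t)=\exp\{-\int_0^tc(X_r)\,dr\}$. A bounded Borel function $u:\mathbb R^d\to\mathbb R$ is a *weak subsolution* of $(-A+c)v=g$ in $D$ if $$u(x)\le\mathbb E_x\big[e_c(\tau_D\wedge t)\,u(X_{\tau_D\wedge t})\big]+\mathbb E_x\Big[\int_0^{\tau_D\wedge t}e_c(r)g(X_r)\,dr\Big],\qquad x\in D,\ t\ge0.$$ Let $m$ be a $\sigma$-finite Borel measure on $D$. A bounded Borel function $\varphi_D:D\to[0,\infty)$ and $\lambda_D\ge0$ are a *non-negative eigenfunction and eigenvalue* if $\int_D\varphi_D\,dm>0$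 and $e^{-\lambda_Dt}\varphi_D(x)=\mathbb E_x[\varphi_D(X_t),\,t<\tau_D]$ for all $t\ge0$, $x\in D$. **Theorem 3.12** (quantitative $\varphi_D$-Hopf lemma). Suppose that $\varphi_D,\lambda_D$ are a non-negative eigenfunction and eigenvalue. Then every weak subsolution $u$ of $(-A+c)v=g$ in $D$ with $\bar u_{D_S}\ge0$ satisfies, with $\|\varphi_D\|_\infty=\sup_D|\varphi_D|$, $$\bar u_{D_S}-u(x)\ge\frac{\varphi_D(x)}{2e\,\|\varphi_D\|_\infty}\left(\frac{\underline c_D\,\bar u_{D_S}}{\lambda_D+\underline c_D}+\frac{\underline{g^-}_D}{\lambda_D+\bar c_D}\right),\qquad x\in D.$$ -/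

import Mathlib

open MeasureTheory ProbabilityTheory Filter Topology
open scoped NNReal ENNReal

namespace LevyHopf

noncomputable section

/-- The state space `ℝᵈ` with its Euclidean norm. -/
abbrev E (d : ℕ) : Type := EuclideanSpace ℝ (Fin d)

/-! ### The integro-differential operator -/

/-- Coefficients `(Q, b, N)` of a Lévy type operator. They live on the whole space, because the
martingale problem evaluates the operator along whole trajectories. On the open set `D` the
functions `Q` and `b` are bounded and `Q` is non-negative definite. `N` is a Lévy kernel: each
`N x` is a measure on `ℝᵈ` not charging the origin, depending measurably on `x`, with
`sup_x ∫ min {1, |y|²} N(x, dy) < ∞` (so that each `N x` is `σ`-finite). -/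
structure LevyOperator (d : ℕ) (D : Set (E d)) where
  Q : E d → Matrix (Fin d) (Fin d) ℝ
  b : E d → E d
  N : Kernel (E d) (E d)
  measurable_Q : ∀ i j, Measurable fun x => Q x i j
  measurable_b : Measurable b
  bounded_Q : ∃ C : ℝ, ∀ x ∈ D, ∀ i j, |Q x i j| ≤ C
  bounded_b : ∃ C : ℝ, ∀ x ∈ D, ∀ i, |b x i| ≤ C
  nonneg_Q : ∀ x ∈ D, ∀ ξ : E d, 0 ≤ ∑ i, ∑ j, Q x i j * ξ i * ξ j
  N_zero : ∀ x, N x {0} = 0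
  N_bounded : (⨆ x, ∫⁻ y, ENNReal.ofReal (min 1 (‖y‖ ^ 2)) ∂(N x)) < ⊤

variable {d : ℕ} {D : Set (E d)}

/-- `A f (x) = ½ Tr(Q(x) ∇²f(x)) + b(x)·∇f(x)
  + ∫ (f(x+y) - f(x) - y·∇f(x) / (1+|y|²)) N(x,dy)`. -/
def LevyOperator.apply (A : LevyOperator d D) (f : E d → ℝ) (x : E d) : ℝ :=
  (1 / 2) * (∑ i, ∑ j, A.Q x i j *
      fderiv ℝ (fderiv ℝ f) x (EuclideanSpace.single i 1) (EuclideanSpace.single j 1))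
    + fderiv ℝ f x (A.b x)
    + ∫ y, (f (x + y) - f x - fderiv ℝ f x y / (1 + ‖y‖ ^ 2)) ∂(A.N x)

/-- `C²` functions on `ℝᵈ` that are bounded together with their first two derivatives. -/
def IsCb2 (f : E d → ℝ) : Prop :=
  ContDiff ℝ 2 f ∧ ∃ C : ℝ, ∀ x, |f x| ≤ C ∧ ‖fderiv ℝ f x‖ ≤ C ∧ ‖fderiv ℝ (fderiv ℝ f) x‖ ≤ C

/-- The range of non-locality `𝒮(D) = ⋃_{x ∈ D} (x + supp N(x,·))`. -/
def LevyOperator.nonlocalRange (A : LevyOperator d D) : Set (E d) :=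
  ⋃ x ∈ D, (fun y => x + y) '' (A.N x).support

/-- The extended boundary `∂_S D = ∂D ∪ (𝒮(D) \ D)`. -/
def LevyOperator.extBoundary (A : LevyOperator d D) : Set (E d) :=
  frontier D ∪ (A.nonlocalRange \ D)

/-- `D_S = ∂_S D ∪ D`. -/
def LevyOperator.extDomain (A : LevyOperator d D) : Set (E d) :=
  A.extBoundary ∪ D

/-- `f̄_B = sup_{x ∈ B} f(x)`. -/
def supOn (f : E d → ℝ) (B : Set (E d)) : ℝ := sSup (f '' B)

/-- `f̲_B = inf_{x ∈ B} f(x)`. -/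
def infOn (f : E d → ℝ) (B : Set (E d)) : ℝ := sInf (f '' B)

/-! ### The canonical path space -/

/-- Right continuous with left limits. -/
def IsCadlag (ω : ℝ≥0 → E d) : Prop :=
  ∀ t, ContinuousWithinAt ω (Set.Ici t) t ∧ ∃ l, Tendsto ω (𝓝[<] t) (𝓝 l)

/-- The space of càdlàg paths `[0,∞) → ℝᵈ`. A solution of the martingale problem is carried by
these paths, so the one-point compactification of `ℝᵈ` plays no role. -/
def CadlagPath (d : ℕ) : Type := {ω : ℝ≥0 → E d // IsCadlag ω}

/-- The canonical process `X_t(ω) = ω(t)`. -/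
def X (t : ℝ≥0) (ω : CadlagPath d) : E d := ω.1 t

/-- The `σ`-algebra generated by the canonical process, which is the Borel `σ`-algebra of the
Skorokhod topology. -/
instance : MeasurableSpace (CadlagPath d) := ⨆ t : ℝ≥0, MeasurableSpace.comap (X t) inferInstance

theorem measurable_X (t : ℝ≥0) : Measurable (X t : CadlagPath d → E d) :=
  (comap_measurable (X t)).mono (le_iSup (fun s : ℝ≥0 =>
    MeasurableSpace.comap (X s : CadlagPath d → E d) inferInstance) t) le_rfl

/-- The natural filtration `ℱ_t = σ(X_s, s ≤ t)` of the canonical process. -/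
def natFilt (d : ℕ) : Filtration ℝ≥0 (inferInstance : MeasurableSpace (CadlagPath d)) :=
  Filtration.natural (fun t => X t) fun t => (measurable_X t).stronglyMeasurable

/-- The shift `θ_t(ω)(s) = ω(t + s)`. -/
def shift (t : ℝ≥0) (ω : CadlagPath d) : CadlagPath d :=
  ⟨fun s => ω.1 (t + s), by
    intro s
    obtain ⟨h1, l, hl⟩ := ω.2 (t + s)
    have hc : Tendsto (fun r : ℝ≥0 => t + r) (𝓝 s) (𝓝 (t + s)) :=
      (continuous_const.add continuous_id).tendsto s
    refine ⟨?_, l, ?_⟩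
    · refine ContinuousWithinAt.comp (t := Set.Ici (t + s)) h1
        (continuous_const.add continuous_id).continuousWithinAt ?_
      intro r hr
      exact add_le_add_right (show s ≤ r from hr) t
    · refine hl.comp (tendsto_nhdsWithin_iff.2 ⟨hc.mono_left nhdsWithin_le_nhds, ?_⟩)
      filter_upwards [self_mem_nhdsWithin] with r hr
      exact add_lt_add_right (show r < s from hr) t⟩

/-! ### The martingale problem -/

/-- `M_t[f] = f(X_t) - f(X_0) - ∫_0^t A f(X_r) dr`. -/
def mgProcess (A : LevyOperator d D) (f : E d → ℝ) (t : ℝ≥0) (ω : CadlagPath d) : ℝ :=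
  f (X t ω) - f (X 0 ω) - ∫ r in (0 : ℝ)..t, A.apply f (X r.toNNReal ω)

/-- `P` solves the martingale problem for `A` with initial distribution `μ`. The time integral in
`M_t[f]` is required to converge absolutely, which is automatic for bounded coefficients. -/
structure SolvesMartingaleProblem (A : LevyOperator d D) (μ : Measure (E d))
    (P : Measure (CadlagPath d)) : Prop where
  isProb : IsProbabilityMeasure P
  initial : P.map (X 0) = μ
  integrable : ∀ f : E d → ℝ, IsCb2 f → ∀ᵐ ω ∂P, ∀ t : ℝ≥0,
    IntervalIntegrable (fun r : ℝ => A.apply f (X r.toNNReal ω)) volume 0 t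
  martingale : ∀ f : E d → ℝ, IsCb2 f → Martingale (mgProcess A f) (natFilt d) P

/-- A strong Markovian solution `(P_x)` of the martingale problem for `A`. That `x ↦ P_x(C)` is
measurable is part of `P` being a kernel. The strong Markov property, with respect to the natural
filtration, reads `P_x(Λ, T < ∞, θ_T ∈ B) = E_x[P_{X_T}(B); Λ, T < ∞]` for all stopping times `T`,
all `Λ ∈ ℱ_T` and all measurable `B`. -/
structure IsStrongMarkovSolution (A : LevyOperator d D) (P : Kernel (E d) (CadlagPath d)) : Prop where
  solves : ∀ x, SolvesMartingaleProblem A (Measure.dirac x) (P x)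
  strongMarkov : ∀ (x : E d) (T : CadlagPath d → WithTop ℝ≥0) (hT : IsStoppingTime (natFilt d) T)
    (Λ : Set (CadlagPath d)), MeasurableSet[hT.measurableSpace] Λ →
    ∀ B : Set (CadlagPath d), MeasurableSet B →
      P x (Λ ∩ {ω | T ω ≠ ⊤ ∧ shift ((T ω).untopD 0) ω ∈ B}) =
        ∫⁻ ω in Λ ∩ {ω | T ω ≠ ⊤}, P (X ((T ω).untopD 0) ω) B ∂(P x)
  mixture : ∀ μ : Measure (E d), IsProbabilityMeasure μ → SolvesMartingaleProblem A μ (μ.bind P)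

/-! ### Exit time, semigroup, eigenfunctions -/

/-- The exit time `τ_D = inf {t > 0 : X_t ∉ D}`, with `inf ∅ = ∞`. -/
def exitTime (D : Set (E d)) (ω : CadlagPath d) : ℝ≥0∞ :=
  ⨅ (t : ℝ≥0) (_ : 0 < t) (_ : X t ω ∉ D), (t : ℝ≥0∞)

/-- `τ_D ∧ t`. -/
def exitMin (D : Set (E d)) (t : ℝ≥0) (ω : CadlagPath d) : ℝ≥0 :=
  (min (exitTime D ω) t).toNNReal

/-- `P^D_t f (x) = E_x[f(X_t), t < τ_D]`; for `x ∈ D` it involves only the values of `f` in `D`. -/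
def killedSemigroup (P : Kernel (E d) (CadlagPath d)) (D : Set (E d)) (t : ℝ≥0) (f : E d → ℝ)
    (x : E d) : ℝ :=
  ∫ ω, {ω | (t : ℝ≥0∞) < exitTime D ω}.indicator (fun ω => f (X t ω)) ω ∂(P x)

/-- `φ` (a bounded Borel function, of which only the values in `D` matter) and `lam` form a
non-negative eigenfunction and eigenvalue in `D`. -/
structure IsNonnegEigenpair (P : Kernel (E d) (CadlagPath d)) (D : Set (E d)) (m : Measure (E d))
    (φ : E d → ℝ) (lam : ℝ) : Prop where
  measurable : Measurable φ
  bounded : ∃ C : ℝ, ∀ x ∈ D, |φ x| ≤ C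
  nonneg : ∀ x ∈ D, 0 ≤ φ x
  eigenvalue_nonneg : 0 ≤ lam
  eigen : ∀ t : ℝ≥0, ∀ x ∈ D, Real.exp (-lam * t) * φ x = killedSemigroup P D t φ x
  integral_pos : 0 < ∫⁻ x in D, ENNReal.ofReal (φ x) ∂m

/-! ### Weak subsolutions -/

/-- `e_c(t) = exp (-∫_0^t c(X_r) dr)`. -/
def expFunctional (c : E d → ℝ) (t : ℝ≥0) (ω : CadlagPath d) : ℝ :=
  Real.exp (-∫ r in (0 : ℝ)..t, c (X r.toNNReal ω))

/-- `E_x ∫_0^{τ_D ∧ t} e_c(r) (-g)(X_r) dr ∈ [0, ∞]`, for `g ≤ 0` in `D`. -/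
def sourceTerm (P : Kernel (E d) (CadlagPath d)) (D : Set (E d)) (c g : E d → ℝ) (t : ℝ≥0)
    (x : E d) : ℝ≥0∞ :=
  ∫⁻ ω, (∫⁻ r in Set.Ioc (0 : ℝ) (exitMin D t ω),
    ENNReal.ofReal (expFunctional c r.toNNReal ω * -g (X r.toNNReal ω))) ∂(P x)

/-- `u` is a weak subsolution of `(-A + c) v = g` in `D`, where `g ≤ 0` is Borel in `D`: `u` is
bounded and Borel on `ℝᵈ` and
`u(x) ≤ E_x[e_c(τ_D ∧ t) u(X_{τ_D ∧ t})] + E_x[∫_0^{τ_D ∧ t} e_c(r) g(X_r) dr]`.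
The last expectation lies in `[-∞, 0]`, and the inequality forces it to be finite. -/
structure IsWeakSubsolution (P : Kernel (E d) (CadlagPath d)) (D : Set (E d)) (c g : E d → ℝ)
    (u : E d → ℝ) : Prop where
  measurable : Measurable u
  bounded : ∃ C : ℝ, ∀ x, |u x| ≤ C
  le : ∀ x ∈ D, ∀ t : ℝ≥0, sourceTerm P D c g t x ≠ ⊤ ∧
    u x ≤ (∫ ω, expFunctional c (exitMin D t ω) ω * u (X (exitMin D t ω) ω) ∂(P x))
      - (sourceTerm P D c g t x).toReal

end

end LevyHopf

open LevyHopf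

/-!
The idea is to insert the eigenfunction into the defining inequality of a weak subsolution. Let `M`
be the supremum of `u` over `D_S`, and let `a ≤ c ≤ b` and `-g ≥ γ ≥ 0` in `D`. If `u ≤ M` at the
stopped position `X_{τ_D ∧ t}`, then the inequality gives
`M - u(x) ≥ M E_x[1 - e_c(τ_D ∧ t)] + E_x ∫_0^{τ_D ∧ t} e_c(r) (-g)(X_r) dr`.
On `{s < τ_D}`, `s ≤ t`, the two random variables on the right are at least `1 - e^{-a s}` and
`s e^{-b s} γ`, and `P_x(s < τ_D) ≥ E_x[φ(X_s), s < τ_D] / ‖φ‖ = e^{-λ s} φ(x) / ‖φ‖` by the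
eigenfunction equation (`integral_discounted_le`, `le_toReal_sourceTerm`). The choices
`s = 1 / (λ + a)` for the first term and `s = 1 / (λ + b)` for the second give the claim.

What takes work is that `u(X_{τ_D ∧ t}) ≤ M` almost surely (`ae_le_supOn_extDomain`), that is, the
process can leave `D` only through `∂D` or by a jump that the Lévy kernel allows from a point *of*
`D`. This has to be derived from the martingale problem, and two points need care.

* The exit time is in general not a Borel function of the path. It is replaced by `outsideHit`, the
  first time after which the path has spent positive time outside `D`. This is a decreasing limit
  of finitely valued stopping times of the natural filtration, and it equals `τ_D` on every path
  that leaves `D` (before the cap) by a jump into the exterior of `D` (`outsideHit_eq_exitTime`).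
* Jumps starting from `∂D` or from outside must not contribute. Up to `outsideHit`, the path is in
  `D` at almost every time (`ae_mem_of_lt_outsideHit`), so the compensator sees only jumps from `D`.

Let `K` be a compact subset of the exterior of `D` into which no jumps from `D` are allowed. Dynkin's
formula at `outsideHit` (optional sampling along the discrete stopping times, with uniform
integrability, because the coefficients may be unbounded outside `D`), applied to cut-off functions
decreasing to the indicator of `K`, shows that the process is almost surely not in `K` at
`outsideHit` (`measure_X_outsideHit_mem_compact`); inner regularity gives the same for Borel sets.

No measurability of `τ_D` is needed for the final estimates: the lower bounds for the events
`{s < τ_D}` are made through the integrable variables `φ(X_s) 1_{s < τ_D} / ‖φ‖ ≤ 1_{s < τ_D}`.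
-/

namespace LevyHopf

open Set Function

variable {d : ℕ} {D : Set (E d)}

/-! ### Joint measurability of right-continuous processes -/

/-- A right-continuous process with values in a metrizable space is jointly measurable, and on
`[0, q]` only the variables up to time `q` matter. This is progressive measurability: in
applications the `σ`-algebra on `Ω` is the one of the past of `q`. -/
theorem measurable_uncurry_of_rightContinuous {Ω F : Type*} [MeasurableSpace Ω]
    [TopologicalSpace F] [TopologicalSpace.PseudoMetrizableSpace F] [MeasurableSpace F]
    [BorelSpace F] {Y : ℝ≥0 → Ω → F} (q : ℝ≥0) (hY : ∀ s ≤ q, Measurable (Y s))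
    (hc : ∀ ω s, ContinuousWithinAt (fun r => Y r ω) (Ici s) s) :
    Measurable fun p : ℝ≥0 × Ω => Y (min p.1 q) p.2 := by
  -- approximate the time argument from the right by the grid of mesh `1 / (n + 1)`
  let r : ℕ → ℝ≥0 → ℝ≥0 := fun n s => (⌊(n + 1 : ℝ≥0) * s⌋₊ + 1 : ℝ≥0) / (n + 1)
  have hr_ge : ∀ n s, s ≤ r n s := fun n s => by
    have hn : (0 : ℝ≥0) < n + 1 := by positivity
    rw [le_div_iff₀ hn, mul_comm]
    exact (Nat.lt_floor_add_one _).le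
  have hr_le : ∀ n s, r n s ≤ s + 1 / (n + 1) := fun n s => by
    have hn : (0 : ℝ≥0) < n + 1 := by positivity
    have h1 : ((n + 1 : ℝ≥0))⁻¹ * (n + 1) = 1 := inv_mul_cancel₀ hn.ne'
    rw [div_le_iff₀ hn, add_mul s, one_div, h1, mul_comm s]
    gcongr
    exact Nat.floor_le (by positivity)
  have hr_lim : ∀ s, Tendsto (fun n => r n s) atTop (𝓝 s) := fun s => by
    refine tendsto_of_tendsto_of_tendsto_of_le_of_le tendsto_const_nhds ?_
      (fun n => hr_ge n s) (fun n => hr_le n s)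
    simpa using (tendsto_const_nhds (x := s)).add
      (tendsto_one_div_add_atTop_nhds_zero_nat (𝕜 := ℝ≥0))
  refine measurable_of_tendsto_metrizable
    (f := fun n (p : ℝ≥0 × Ω) => Y (min (r n p.1) q) p.2) (fun n => ?_) ?_
  · obtain ⟨a, ha⟩ : ∃ a : ℕ → ℝ≥0, ∀ s, r n s = a ⌊(n + 1 : ℝ≥0) * s⌋₊ :=
      ⟨fun k => (k + 1 : ℝ≥0) / (n + 1), fun s => rfl⟩
    have h1 : Measurable fun p : Ω × ℕ => Y (min (a p.2) q) p.1 :=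
      measurable_from_prod_countable_left fun k => hY (min (a k) q) (min_le_right _ _)
    have hfloor : Measurable fun s : ℝ≥0 => ⌊(n + 1 : ℝ≥0) * s⌋₊ :=
      Nat.measurable_floor.comp (measurable_id.const_mul (n + 1 : ℝ≥0))
    have h2 : Measurable fun p : ℝ≥0 × Ω => (p.2, ⌊(n + 1 : ℝ≥0) * p.1⌋₊) :=
      measurable_snd.prodMk (hfloor.comp measurable_fst)
    simp only [ha]
    exact h1.comp h2
  · refine tendsto_pi_nhds.2 fun p => ?_
    refine (hc p.2 (min p.1 q)).tendsto.comp (tendsto_nhdsWithin_iff.2 ⟨?_, ?_⟩)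
    · exact (hr_lim p.1).min tendsto_const_nhds
    · exact Eventually.of_forall fun n => min_le_min_right q (hr_ge n p.1)

theorem continuousWithinAt_X (ω : CadlagPath d) (s : ℝ≥0) :
    ContinuousWithinAt (fun r => X r ω) (Ici s) s := (ω.2 s).1

theorem measurable_path (ω : CadlagPath d) : Measurable fun r : ℝ => X r.toNNReal ω := by
  -- on the one-point measurable space carrying `ω`, every variable is measurable
  have h : ∀ q : ℝ≥0, Measurable fun r : ℝ≥0 => X (min r q) ω := fun q =>
    (measurable_uncurry_of_rightContinuous (Ω := Unit) (Y := fun s _ => X s ω) q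
      (fun _ _ => measurable_const) (fun _ s => continuousWithinAt_X ω s)).comp
      (measurable_id.prodMk (measurable_const (a := ())))
  have h' : Measurable fun r : ℝ≥0 => X r ω := by
    refine measurable_of_tendsto_metrizable (fun n : ℕ => h n) (tendsto_pi_nhds.2 fun r => ?_)
    obtain ⟨N, hN⟩ := exists_nat_ge r
    refine tendsto_const_nhds.congr' ?_
    filter_upwards [eventually_ge_atTop N] with n hn
    rw [min_eq_left (hN.trans (by exact_mod_cast hn))]
  exact h'.comp measurable_real_toNNReal

/-- `X_s` is measurable with respect to the past of any later time. -/
theorem measurable_X_natFilt {s q : ℝ≥0} (h : s ≤ q) :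
    Measurable[natFilt d q] (X s : CadlagPath d → E d) :=
  (comap_measurable (X s)).mono
    (le_iSup₂ (f := fun j (_ : j ≤ q) => MeasurableSpace.comap (X j : CadlagPath d → E d) _) s h)
    le_rfl

/-! ### The first time that the path has spent positive time outside `D` -/

/-- The time that the path spends outside `D` during `(0, q]`. -/
noncomputable def outsideTime (D : Set (E d)) (q : ℝ≥0) (ω : CadlagPath d) : ℝ≥0∞ :=
  volume ({s : ℝ | X s.toNNReal ω ∉ D} ∩ Ioc 0 (q : ℝ))

theorem measurable_outsideTime (hD : MeasurableSet D) (q : ℝ≥0) :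
    Measurable[natFilt d q] (outsideTime D q) := by
  have key : ∀ {Ω : Type} [MeasurableSpace Ω] (Y : ℝ≥0 → Ω → E d),
      (∀ s ≤ q, Measurable (Y s)) → (∀ ω s, ContinuousWithinAt (fun r => Y r ω) (Ici s) s) →
      Measurable fun ω => volume ({s : ℝ | Y s.toNNReal ω ∉ D} ∩ Ioc 0 (q : ℝ)) := by
    intro Ω _ Y hY hc
    have h1 : Measurable fun p : Ω × ℝ => Y (min p.2.toNNReal q) p.1 :=
      (measurable_uncurry_of_rightContinuous q hY hc).comp
        ((measurable_real_toNNReal.comp measurable_snd).prodMk measurable_fst)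
    have h2 : MeasurableSet {p : Ω × ℝ | Y (min p.2.toNNReal q) p.1 ∉ D ∧ p.2 ∈ Ioc 0 (q : ℝ)} :=
      (h1 hD.compl).inter (measurable_snd measurableSet_Ioc)
    convert measurable_measure_prodMk_left (ν := (volume : Measure ℝ)) h2 using 3 with ω
    ext s
    simp only [mem_inter_iff, mem_ofPred_eq, mem_preimage, and_congr_left_iff]
    intro hs
    rw [min_eq_left (Real.toNNReal_le_iff_le_coe.2 hs.2)]
  exact @key (CadlagPath d) (natFilt d q) X (fun s hs => measurable_X_natFilt hs)
    continuousWithinAt_X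

open Classical in
/-- The smallest of the first `n` members `q` of a dense sequence of times for which the path has
spent positive time outside `D` before `q`, or `H` if there is none below `H`. -/
noncomputable def outsideApprox (D : Set (E d)) (H : ℝ≥0) : ℕ → CadlagPath d → ℝ≥0
  | 0, _ => H
  | n + 1, ω =>
    if 0 < outsideTime D (TopologicalSpace.denseSeq ℝ≥0 n) ω ∧
        TopologicalSpace.denseSeq ℝ≥0 n < outsideApprox D H n ω then
      TopologicalSpace.denseSeq ℝ≥0 n
    else outsideApprox D H n ω

/-- The first time, capped at `H`, after which the path has spent positive time outside `D`. -/
noncomputable def outsideHit (D : Set (E d)) (H : ℝ≥0) (ω : CadlagPath d) : ℝ≥0 :=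
  ⨅ n, outsideApprox D H n ω

theorem outsideApprox_succ_le (H : ℝ≥0) (n : ℕ) (ω : CadlagPath d) :
    outsideApprox D H (n + 1) ω ≤ outsideApprox D H n ω := by
  rw [outsideApprox]
  split_ifs with h
  exacts [h.2.le, le_rfl]

theorem outsideApprox_antitone (H : ℝ≥0) (ω : CadlagPath d) :
    Antitone fun n => outsideApprox D H n ω :=
  antitone_nat_of_succ_le fun n => outsideApprox_succ_le H n ω

theorem outsideApprox_le (H : ℝ≥0) (n : ℕ) (ω : CadlagPath d) : outsideApprox D H n ω ≤ H :=
  outsideApprox_antitone H ω (Nat.zero_le n)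

theorem outsideHit_le_approx (H : ℝ≥0) (n : ℕ) (ω : CadlagPath d) :
    outsideHit D H ω ≤ outsideApprox D H n ω :=
  ciInf_le (OrderBot.bddBelow _) n

theorem outsideHit_le (H : ℝ≥0) (ω : CadlagPath d) : outsideHit D H ω ≤ H :=
  outsideHit_le_approx H 0 ω

theorem tendsto_outsideApprox (H : ℝ≥0) (ω : CadlagPath d) :
    Tendsto (fun n => outsideApprox D H n ω) atTop (𝓝 (outsideHit D H ω)) :=
  tendsto_atTop_ciInf (outsideApprox_antitone H ω) (OrderBot.bddBelow _)

theorem tendsto_X_outsideApprox (H : ℝ≥0) (ω : CadlagPath d) :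
    Tendsto (fun n => X (outsideApprox D H n ω) ω) atTop (𝓝 (X (outsideHit D H ω) ω)) :=
  (continuousWithinAt_X ω _).tendsto.comp (tendsto_nhdsWithin_iff.2
    ⟨tendsto_outsideApprox H ω, Eventually.of_forall fun n => outsideHit_le_approx H n ω⟩)

theorem isStoppingTime_outsideApprox (hD : MeasurableSet D) (H : ℝ≥0) (n : ℕ) :
    IsStoppingTime (natFilt d) fun ω => (outsideApprox D H n ω : WithTop ℝ≥0) := by
  induction n with
  | zero => exact isStoppingTime_const _ _
  | succ n ih =>
    intro i
    set q := TopologicalSpace.denseSeq ℝ≥0 n with hq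
    have : {ω : CadlagPath d | (outsideApprox D H (n + 1) ω : WithTop ℝ≥0) ≤ i} =
        {ω | (outsideApprox D H n ω : WithTop ℝ≥0) ≤ i} ∪ {ω | q ≤ i ∧ 0 < outsideTime D q ω} := by
      ext ω
      simp only [mem_ofPred_eq, mem_union, outsideApprox, ← hq, WithTop.coe_le_coe]
      split_ifs with h
      · exact ⟨fun h' => Or.inr ⟨h', h.1⟩, fun h' => h'.elim (h.2.le.trans ·) (·.1)⟩
      · refine ⟨Or.inl, fun h' => h'.elim id fun h'' => ?_⟩
        exact (not_lt.1 fun h3 => h ⟨h''.2, h3⟩).trans h''.1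
    rw [this]
    refine (ih i).union ?_
    by_cases hqi : q ≤ i
    · simp only [hqi, true_and]
      exact (natFilt d).mono hqi _ (measurable_outsideTime hD q measurableSet_Ioi)
    · simp [hqi]

theorem finite_range_outsideApprox (D : Set (E d)) (H : ℝ≥0) (n : ℕ) :
    (range (outsideApprox D H n)).Finite := by
  induction n with
  | zero => exact (finite_singleton H).subset (by rintro _ ⟨ω, rfl⟩; rfl)
  | succ n ih =>
    refine (ih.insert (TopologicalSpace.denseSeq ℝ≥0 n)).subset ?_
    rintro _ ⟨ω, rfl⟩
    rw [outsideApprox]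
    split_ifs
    exacts [mem_insert _ _, mem_insert_of_mem _ ⟨ω, rfl⟩]

open Classical in
theorem measurable_X_outsideHit (hD : MeasurableSet D) (H : ℝ≥0) :
    Measurable fun ω : CadlagPath d => X (outsideHit D H ω) ω := by
  have key : ∀ n, Measurable (outsideApprox D H n) ∧
      Measurable fun ω : CadlagPath d => X (outsideApprox D H n ω) ω := by
    intro n
    induction n with
    | zero => exact ⟨measurable_const, measurable_X H⟩
    | succ n ih =>
      have hm : MeasurableSet {ω : CadlagPath d |
          0 < outsideTime D (TopologicalSpace.denseSeq ℝ≥0 n) ω ∧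
            TopologicalSpace.denseSeq ℝ≥0 n < outsideApprox D H n ω} :=
        ((natFilt d).le _ _ (measurable_outsideTime hD _ measurableSet_Ioi)).inter
          (ih.1 measurableSet_Ioi)
      refine ⟨Measurable.ite hm measurable_const ih.1, ?_⟩
      have : (fun ω : CadlagPath d => X (outsideApprox D H (n + 1) ω) ω) = fun ω =>
          if 0 < outsideTime D (TopologicalSpace.denseSeq ℝ≥0 n) ω ∧
            TopologicalSpace.denseSeq ℝ≥0 n < outsideApprox D H n ω then
            X (TopologicalSpace.denseSeq ℝ≥0 n) ω else X (outsideApprox D H n ω) ω := by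
        ext1 ω
        rw [outsideApprox]
        split_ifs <;> rfl
      rw [this]
      exact Measurable.ite hm (measurable_X _) ih.2
  exact measurable_of_tendsto_metrizable (fun n => (key n).2)
    (tendsto_pi_nhds.2 fun ω => tendsto_X_outsideApprox H ω)

theorem outsideHit_le_denseSeq {H : ℝ≥0} {n : ℕ} {ω : CadlagPath d}
    (h : 0 < outsideTime D (TopologicalSpace.denseSeq ℝ≥0 n) ω) :
    outsideHit D H ω ≤ TopologicalSpace.denseSeq ℝ≥0 n := by
  refine (outsideHit_le_approx H (n + 1) ω).trans ?_
  rw [outsideApprox]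
  split_ifs with h'
  exacts [le_rfl, not_lt.1 fun h3 => h' ⟨h, h3⟩]

/-- Before `outsideHit`, the path is in `D` at almost every time. -/
theorem ae_mem_of_lt_outsideHit (H : ℝ≥0) (ω : CadlagPath d) :
    ∀ᵐ s : ℝ, s ∈ Ioc (0 : ℝ) (outsideHit D H ω) → X s.toNNReal ω ∈ D := by
  have hz : ∀ n, TopologicalSpace.denseSeq ℝ≥0 n < outsideHit D H ω →
      volume ({s : ℝ | X s.toNNReal ω ∉ D} ∩ Ioc 0 (TopologicalSpace.denseSeq ℝ≥0 n : ℝ)) = 0 :=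
    fun n hn => by
      by_contra hne
      exact hn.not_ge (outsideHit_le_denseSeq (pos_iff_ne_zero.2 hne))
  have hall : ∀ᵐ s : ℝ, ∀ n, TopologicalSpace.denseSeq ℝ≥0 n < outsideHit D H ω →
      s ∉ {s : ℝ | X s.toNNReal ω ∉ D} ∩ Ioc 0 (TopologicalSpace.denseSeq ℝ≥0 n : ℝ) := by
    refine ae_all_iff.2 fun n => ?_
    by_cases hn : TopologicalSpace.denseSeq ℝ≥0 n < outsideHit D H ω
    · filter_upwards [measure_eq_zero_iff_ae_notMem.1 (hz n hn)] with s hs _ using hs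
    · exact Eventually.of_forall fun s h => absurd h hn
  have hne : ∀ᵐ s : ℝ, s ≠ (outsideHit D H ω : ℝ) := by
    simp [ae_iff, measure_singleton]
  filter_upwards [hall, hne] with s hs hs' hmem
  by_contra hcon
  have hlt : s.toNNReal < outsideHit D H ω := by
    rw [Real.toNNReal_lt_iff_lt_coe hmem.1.le]
    exact lt_of_le_of_ne hmem.2 hs'
  obtain ⟨_, ⟨n, rfl⟩, h1, h2⟩ :=
    (TopologicalSpace.denseRange_denseSeq ℝ≥0).exists_between hlt
  exact hs n h2 ⟨hcon, hmem.1, (Real.toNNReal_le_iff_le_coe).1 h1.le⟩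

/-! ### Exit time of a single path -/

theorem mem_of_lt_exitTime {ω : CadlagPath d} {s : ℝ≥0} (hs : 0 < s)
    (h : (s : ℝ≥0∞) < exitTime D ω) : X s ω ∈ D := by
  by_contra hn
  exact h.not_ge (iInf_le_of_le s (iInf_le_of_le hs (iInf_le_of_le hn le_rfl)))

/-- At a finite exit time from an open set, a càdlàg path is outside the set. -/
theorem X_exitTime_notMem (hD : IsOpen D) {ω : CadlagPath d} {τ : ℝ≥0}
    (h : exitTime D ω = τ) : X τ ω ∉ D := by
  intro hmem
  have hev : ∀ᶠ s in 𝓝[≥] τ, X s ω ∈ D := continuousWithinAt_X ω τ (hD.mem_nhds hmem)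
  obtain ⟨η, hη, hsub⟩ := (mem_nhdsGE_iff_exists_Ico_subset' (show τ < τ + 1 by simp)).1 hev
  have : (η : ℝ≥0∞) ≤ exitTime D ω := by
    refine le_iInf fun s => le_iInf fun hs => le_iInf fun hsD => ?_
    have hτs : τ ≤ s := by
      have : exitTime D ω ≤ s := iInf_le_of_le s (iInf_le_of_le hs (iInf_le_of_le hsD le_rfl))
      rw [h] at this
      exact_mod_cast this
    by_contra hlt
    exact hsD (hsub ⟨hτs, by exact_mod_cast not_le.1 hlt⟩)
  rw [h] at this
  exact (lt_irrefl _ (hη.trans_le (by exact_mod_cast this)))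

/-- If the path exits `D` before `H` by a jump to the exterior of `D`, then it spends positive time
outside `D` immediately afterwards, so that `outsideHit` is the exit time. -/
theorem outsideHit_eq_exitTime {H τ : ℝ≥0} {ω : CadlagPath d} (h : exitTime D ω = τ) (hH : τ < H)
    (hX : X τ ω ∉ closure D) : outsideHit D H ω = τ := by
  refine le_antisymm ?_ (le_ciInf fun n => ?_)
  · have hev : ∀ᶠ s in 𝓝[≥] τ, X s ω ∈ (closure D)ᶜ :=
      continuousWithinAt_X ω τ (isClosed_closure.isOpen_compl.mem_nhds hX)
    obtain ⟨η, hη, hsub⟩ := (mem_nhdsGE_iff_exists_Ico_subset' (show τ < τ + 1 by simp)).1 hev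
    refine le_of_forall_gt fun ξ hξ => ?_
    obtain ⟨_, ⟨n, rfl⟩, h1, h2⟩ := (TopologicalSpace.denseRange_denseSeq ℝ≥0).exists_between
      (lt_min hη hξ : τ < min η ξ)
    refine lt_of_le_of_lt (outsideHit_le_denseSeq ?_) (lt_min_iff.1 h2).2
    set q := TopologicalSpace.denseSeq ℝ≥0 n
    have hpos : 0 < volume (Ioc (τ : ℝ) q) := by
      rw [Real.volume_Ioc, ENNReal.ofReal_pos, sub_pos]
      exact_mod_cast h1
    refine hpos.trans_le (measure_mono fun s hs => ?_)
    have hs0 : 0 < s := lt_of_le_of_lt τ.2 hs.1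
    refine ⟨fun hsD => ?_, hs0, hs.2⟩
    refine hsub (a := s.toNNReal) ⟨NNReal.le_toNNReal_of_coe_le hs.1.le, ?_⟩ (subset_closure hsD)
    exact lt_of_le_of_lt (Real.toNNReal_le_iff_le_coe.2 hs.2) (lt_min_iff.1 h2).1
  · induction n with
    | zero => exact hH.le
    | succ n ih =>
      rw [outsideApprox]
      split_ifs with hc
      swap
      · exact ih
      by_contra hlt
      rw [not_le] at hlt
      refine hc.1.ne' (measure_mono_null (fun s hs => ?_) measure_empty)
      have hs0 : 0 < s.toNNReal := Real.toNNReal_pos.2 hs.2.1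
      refine hs.1 (mem_of_lt_exitTime hs0 ?_)
      rw [h]
      exact_mod_cast (Real.toNNReal_le_iff_le_coe.2 hs.2.2).trans_lt hlt

/-! ### Optional sampling along discrete stopping times -/

/-- Optional sampling in continuous time: if finitely valued stopping times bounded by `H` are
such that the stopped values of a martingale converge almost surely, then the limit has the
expectation of the martingale. The stopped values are conditional expectations of the value at `H`,
hence uniformly integrable. -/
theorem integral_eq_of_tendsto_stopped {Ω : Type*} {m0 : MeasurableSpace Ω} {P : Measure Ω}
    [IsFiniteMeasure P] {ℱ : Filtration ℝ≥0 m0} {M : ℝ≥0 → Ω → ℝ} (hM : Martingale M ℱ P)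
    {H : ℝ≥0} {T : ℕ → Ω → ℝ≥0}
    (hT : ∀ n, IsStoppingTime ℱ fun ω => (T n ω : WithTop ℝ≥0)) (hle : ∀ n ω, T n ω ≤ H)
    (hfin : ∀ n, (range (T n)).Finite) {Z : Ω → ℝ}
    (hZ : ∀ᵐ ω ∂P, Tendsto (fun n => M (T n ω) ω) atTop (𝓝 (Z ω))) :
    Integrable Z P ∧ ∫ ω, Z ω ∂P = ∫ ω, M 0 ω ∂P := by
  have hce : ∀ n, (P[M H | (hT n).measurableSpace]) =ᵐ[P] fun ω => M (T n ω) ω := by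
    intro n
    have hcount : (range fun ω => (T n ω : WithTop ℝ≥0)).Countable := by
      have := ((hfin n).image (fun t : ℝ≥0 => (t : WithTop ℝ≥0))).countable
      rwa [← range_comp] at this
    have := hM.stoppedValue_ae_eq_condExp_of_le_const_of_countable_range (hT n) (n := H)
      (fun ω => WithTop.coe_le_coe.2 (hle n ω)) hcount
    exact this.symm
  have hle' : ∀ n, (hT n).measurableSpace ≤ m0 := fun n => (hT n).measurableSpace_le
  have hUI : UniformIntegrable (fun n ω => M (T n ω) ω) 1 P :=
    ((hM.integrable H).uniformIntegrable_condExp hle').ae_eq hce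
  have hZint : Integrable Z P := hUI.integrable_of_ae_tendsto hZ
  refine ⟨hZint, ?_⟩
  have hmean : ∀ n, ∫ ω, M (T n ω) ω ∂P = ∫ ω, M 0 ω ∂P := fun n => by
    rw [← integral_congr_ae (hce n), integral_condExp (hle' n), ← setIntegral_univ,
      ← hM.setIntegral_eq (zero_le (a := H)) MeasurableSet.univ, setIntegral_univ]
  have hlim := tendsto_integral_of_L1' Z hZint.1
    (Eventually.of_forall fun n => (memLp_one_iff_integrable.1 (hUI.memLp n)))
    (tendsto_Lp_finite_of_tendsto_ae le_rfl ENNReal.one_ne_top (fun n => hUI.1 n)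
      (memLp_one_iff_integrable.2 hZint) hUI.2.1 hZ)
  simp only [hmean] at hlim
  exact tendsto_nhds_unique hlim tendsto_const_nhds |>.symm ▸ rfl

/-- Dynkin's formula at `outsideHit`: the martingale `M[f]` has mean zero there. -/
theorem integral_mgProcess_outsideHit (hD : MeasurableSet D) {A : LevyOperator d D}
    {μ : Measure (E d)} {P : Measure (CadlagPath d)} (hP : SolvesMartingaleProblem A μ P)
    {f : E d → ℝ} (hf : IsCb2 f) (H : ℝ≥0) :
    Integrable (fun ω => mgProcess A f (outsideHit D H ω) ω) P ∧
      ∫ ω, mgProcess A f (outsideHit D H ω) ω ∂P = 0 := by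
  have := hP.isProb
  have hlim : ∀ᵐ ω ∂P, Tendsto (fun n => mgProcess A f (outsideApprox D H n ω) ω) atTop
      (𝓝 (mgProcess A f (outsideHit D H ω) ω)) := by
    filter_upwards [hP.integrable f hf] with ω hω
    refine Tendsto.sub (Tendsto.sub ?_ tendsto_const_nhds) ?_
    · exact (hf.1.continuous.tendsto _).comp (tendsto_X_outsideApprox H ω)
    · have hc := intervalIntegral.continuousOn_primitive_interval' (hω H) left_mem_uIcc
      rw [uIcc_of_le (NNReal.coe_nonneg H)] at hc
      refine (hc (outsideHit D H ω) ⟨NNReal.coe_nonneg _, ?_⟩).tendsto.comp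
        (tendsto_nhdsWithin_iff.2 ⟨?_, Eventually.of_forall fun n => ⟨NNReal.coe_nonneg _, ?_⟩⟩)
      · exact_mod_cast outsideHit_le H ω
      · exact NNReal.tendsto_coe.2 (tendsto_outsideApprox H ω)
      · exact_mod_cast outsideApprox_le H n ω
  have h := integral_eq_of_tendsto_stopped (hP.martingale f hf)
    (isStoppingTime_outsideApprox hD H) (outsideApprox_le H) (finite_range_outsideApprox D H) hlim
  refine ⟨h.1, h.2.trans ?_⟩
  simp [mgProcess]

/-! ### The operator on functions that vanish near `D` -/

/-- The mass that the Lévy kernel gives to jumps of size at least `δ` is bounded. -/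
theorem LevyOperator.exists_bound_large_jumps (A : LevyOperator d D) {δ : ℝ} (hδ : 0 < δ) :
    ∃ C : ℝ≥0, ∀ x, A.N x {y | δ ≤ ‖y‖} ≤ C := by
  have hpos : 0 < min 1 (δ ^ 2) := by positivity
  have hne : ENNReal.ofReal (min 1 (δ ^ 2)) ≠ 0 := (ENNReal.ofReal_pos.2 hpos).ne'
  refine ⟨((⨆ x, ∫⁻ y, ENNReal.ofReal (min 1 (‖y‖ ^ 2)) ∂(A.N x)) /
    ENNReal.ofReal (min 1 (δ ^ 2))).toNNReal, fun x => ?_⟩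
  rw [ENNReal.coe_toNNReal (ENNReal.div_ne_top A.N_bounded.ne hne)]
  rw [ENNReal.le_div_iff_mul_le (Or.inl hne) (Or.inl ENNReal.ofReal_ne_top), mul_comm]
  refine le_trans ?_ (le_iSup (fun x => ∫⁻ y, ENNReal.ofReal (min 1 (‖y‖ ^ 2)) ∂(A.N x)) x)
  refine le_trans (mul_le_mul_right (measure_mono fun y (hy : δ ≤ ‖y‖) => ?_) _)
    (mul_meas_ge_le_lintegral₀ (by fun_prop) _)
  exact ENNReal.ofReal_le_ofReal (min_le_min_left _ (by gcongr))

theorem LevyOperator.apply_of_eventuallyEq_zero (A : LevyOperator d D) {f : E d → ℝ} {x : E d}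
    (h : f =ᶠ[𝓝 x] 0) : A.apply f x = ∫ y, f (x + y) ∂(A.N x) := by
  have h1 : fderiv ℝ f =ᶠ[𝓝 x] 0 := by
    have := h.fderiv (𝕜 := ℝ)
    filter_upwards [this] with y hy
    rw [hy]; simp
  have h2 : fderiv ℝ (fderiv ℝ f) x = 0 := by
    rw [h1.fderiv_eq]; simp
  simp [LevyOperator.apply, h.eq_of_nhds, h1.eq_of_nhds, h2]

theorem exists_bound_fderiv_of_hasCompactSupport {V W : Type*} [NormedAddCommGroup V]
    [NormedSpace ℝ V] [NormedAddCommGroup W] [NormedSpace ℝ W] {f : V → W} (hf : ContDiff ℝ 1 f)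
    (hc : HasCompactSupport f) : ∃ C, ∀ x, ‖fderiv ℝ f x‖ ≤ C :=
  (hc.fderiv (𝕜 := ℝ)).exists_bound_of_continuous (hf.continuous_fderiv one_ne_zero)

theorem isCb2_of_hasCompactSupport {f : E d → ℝ} (hf : ContDiff ℝ 2 f)
    (hc : HasCompactSupport f) : IsCb2 f := by
  obtain ⟨C0, hC0⟩ := hc.exists_bound_of_continuous hf.continuous
  obtain ⟨C1, hC1⟩ := exists_bound_fderiv_of_hasCompactSupport (hf.of_le one_le_two) hc
  obtain ⟨C2, hC2⟩ := exists_bound_fderiv_of_hasCompactSupport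
    (hf.fderiv_right one_add_one_eq_two.le) (hc.fderiv (𝕜 := ℝ))
  refine ⟨hf, max C0 (max C1 C2), fun x => ⟨?_, ?_, ?_⟩⟩
  · exact (hC0 x).trans (le_max_left _ _)
  · exact (hC1 x).trans (le_max_of_le_right (le_max_left _ _))
  · exact (hC2 x).trans (le_max_of_le_right (le_max_right _ _))

/-- Smooth cut-off functions: `f` is `1` on the compact set `K` and vanishes outside its
`ε`-thickening. -/
theorem exists_isCb2_cutoff {K : Set (E d)} (hK : IsCompact K) {ε : ℝ} (hε : 0 < ε) :
    ∃ f : E d → ℝ, IsCb2 f ∧ (∀ z, 0 ≤ f z) ∧ (∀ z, f z ≤ 1) ∧ (∀ z ∈ K, f z = 1) ∧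
      ∀ z ∉ Metric.thickening ε K, f z = 0 := by
  obtain ⟨f, hf, hr, hs, h1⟩ := exists_contMDiff_support_eq_eq_one_iff (n := 2)
    (modelWithCornersSelf ℝ (E d)) (Metric.isOpen_thickening (δ := ε) (E := K)) hK.isClosed
    (Metric.self_subset_thickening hε K)
  have hcs : HasCompactSupport f := by
    rw [HasCompactSupport, tsupport, hs]
    exact (hK.isBounded.thickening).isCompact_closure
  refine ⟨f, isCb2_of_hasCompactSupport hf.contDiff hcs, fun z => (hr ⟨z, rfl⟩).1,
    fun z => (hr ⟨z, rfl⟩).2, fun z hz => (h1 z).1 hz, fun z hz => ?_⟩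
  rwa [← notMem_support, hs]

/-! ### The law of the process at a jump out of `D` -/

theorem ae_X_zero_eq {A : LevyOperator d D} {x : E d} {P : Measure (CadlagPath d)}
    (hP : SolvesMartingaleProblem A (Measure.dirac x) P) : ∀ᵐ ω ∂P, X 0 ω = x := by
  have : ∀ᵐ z ∂(P.map (X 0)), z = x := by
    rw [hP.initial]
    exact (ae_dirac_iff (measurableSet_singleton x)).2 rfl
  exact ae_of_ae_map (measurable_X 0).aemeasurable this

/-- If the Lévy kernel does not allow jumps from `D` into the compact set `K` in the exterior of
`D`, then the process is not in `K` at the time `outsideHit`. Apply Dynkin's formula to cut-off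
functions `f j` decreasing to the indicator of `K`: at almost every time before `outsideHit` the
path is in `D`, where `A (f j)` reduces to the integral against the Lévy kernel, is bounded
uniformly in `j`, and tends to `0`. -/
theorem measure_X_outsideHit_mem_compact (hD : MeasurableSet D) {A : LevyOperator d D} {x : E d}
    (hx : x ∈ D) {P : Measure (CadlagPath d)}
    (hP : SolvesMartingaleProblem A (Measure.dirac x) P) {K : Set (E d)} (hK : IsCompact K)
    (hKD : Disjoint K (closure D)) (hN : ∀ z ∈ D, A.N z {y | z + y ∈ K} = 0) (H : ℝ≥0) :
    P {ω | X (outsideHit D H ω) ω ∈ K} = 0 := by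
  have := hP.isProb
  obtain ⟨δ, hδ, hdisj⟩ := hKD.exists_thickenings hK isClosed_closure
  have hε : ∀ j : ℕ, 0 < δ / (j + 1) := fun j => by positivity
  have hεle : ∀ j : ℕ, δ / (j + 1) ≤ δ := fun j =>
    div_le_self hδ.le (by linarith [(Nat.cast_nonneg j : (0 : ℝ) ≤ j)])
  choose f hfC hf0 hf1 hfK hfz using fun j => exists_isCb2_cutoff hK (hε j)
  have hfz' : ∀ j, ∀ z ∉ Metric.thickening δ K, f j z = 0 := fun j z hz =>
    hfz j z fun h => hz (Metric.thickening_mono (hεle j) K h)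
  have hfD : ∀ j, ∀ z ∈ Metric.thickening δ (closure D), f j z = 0 := fun j z hz =>
    hfz' j z fun h => disjoint_left.1 hdisj h hz
  have hcl : ∀ z ∈ D, z ∈ Metric.thickening δ (closure D) := fun z hz =>
    Metric.self_subset_thickening hδ _ (subset_closure hz)
  have hlarge : ∀ j, ∀ z ∈ D, ∀ y, f j (z + y) ≠ 0 → δ ≤ ‖y‖ := fun j z hz y hy => by
    by_contra hlt
    refine hy (hfD j _ (Metric.mem_thickening_iff.2 ⟨z, subset_closure hz, ?_⟩))
    simpa [dist_eq_norm] using not_le.1 hlt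
  have happly : ∀ j, ∀ z ∈ D, A.apply (f j) z = ∫ y, f j (z + y) ∂(A.N z) := fun j z hz =>
    A.apply_of_eventuallyEq_zero (mem_of_superset
      (Metric.isOpen_thickening.mem_nhds (hcl z hz)) fun w hw => hfD j w hw)
  obtain ⟨C, hC⟩ := A.exists_bound_large_jumps hδ
  have hmeasL : MeasurableSet {y : E d | δ ≤ ‖y‖} :=
    measurableSet_le measurable_const measurable_norm
  have hind : ∀ z, Integrable ({y : E d | δ ≤ ‖y‖}.indicator fun _ => (1 : ℝ)) (A.N z) :=
    fun z => (integrable_indicator_iff hmeasL).2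
      (integrableOn_const ((hC z).trans_lt ENNReal.coe_lt_top).ne)
  have hdom : ∀ j, ∀ z ∈ D, ∀ y,
      ‖f j (z + y)‖ ≤ {y : E d | δ ≤ ‖y‖}.indicator (fun _ => (1 : ℝ)) y := fun j z hz y => by
    by_cases hy : f j (z + y) = 0
    · rw [hy, norm_zero]
      exact indicator_nonneg (fun _ _ => zero_le_one) y
    · rw [indicator_of_mem (show y ∈ {y : E d | δ ≤ ‖y‖} from hlarge j z hz y hy),
        Real.norm_of_nonneg (hf0 j _)]
      exact hf1 j _
  have hbound : ∀ j, ∀ z ∈ D, ‖A.apply (f j) z‖ ≤ C := fun j z hz => by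
    rw [happly j z hz]
    refine (norm_integral_le_of_norm_le (hind z) (Eventually.of_forall (hdom j z hz))).trans ?_
    rw [integral_indicator_const _ hmeasL, smul_eq_mul, mul_one]
    exact ENNReal.toReal_le_coe_of_le_coe (hC z)
  have hlim0 : ∀ z ∈ D, Tendsto (fun j => A.apply (f j) z) atTop (𝓝 0) := fun z hz => by
    simp only [happly _ z hz]
    rw [← integral_zero (E d) ℝ (μ := A.N z)]
    refine tendsto_integral_of_dominated_convergence _
      (fun j => ((hfC j).1.continuous.comp (continuous_const.add continuous_id)).aestronglyMeasurable)
      (hind z) (fun j => Eventually.of_forall (hdom j z hz)) ?_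
    filter_upwards [measure_eq_zero_iff_ae_notMem.1 (hN z hz)] with y hy
    -- a point outside the compact set `K` is eventually outside its shrinking thickenings
    obtain ⟨r, hr, hrd⟩ := (disjoint_singleton_left.2 hy).exists_thickenings
      isCompact_singleton hK.isClosed
    refine tendsto_const_nhds.congr' ?_
    have hsmall : Tendsto (fun j : ℕ => δ / ((j : ℝ) + 1)) atTop (𝓝 0) :=
      tendsto_const_nhds.div_atTop (tendsto_atTop_add_const_right _ 1 tendsto_natCast_atTop_atTop)
    filter_upwards [hsmall.eventually_lt_const hr] with j hj
    refine (hfz j _ fun h => disjoint_left.1 hrd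
      (Metric.self_subset_thickening hr _ rfl) (Metric.thickening_mono hj.le K h)).symm
  -- the compensator at `outsideHit` is bounded and tends to zero
  have hcomp : ∀ᵐ ω ∂P, (∀ j, ‖∫ r in (0 : ℝ)..outsideHit D H ω,
        A.apply (f j) (X r.toNNReal ω)‖ ≤ C * H) ∧
      Tendsto (fun j => ∫ r in (0 : ℝ)..outsideHit D H ω, A.apply (f j) (X r.toNNReal ω))
        atTop (𝓝 0) := by
    filter_upwards [ae_all_iff.2 fun j => hP.integrable (f j) (hfC j)] with ω hω
    have hmem := ae_mem_of_lt_outsideHit (D := D) H ω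
    have hT : (0 : ℝ) ≤ outsideHit D H ω := NNReal.coe_nonneg _
    refine ⟨fun j => ?_, ?_⟩
    · have h1 := intervalIntegral.norm_integral_le_of_norm_le_const_ae (a := 0)
        (b := (outsideHit D H ω : ℝ)) (C := C) (f := fun r => A.apply (f j) (X r.toNNReal ω)) (by
          filter_upwards [hmem] with r hr hr'
          rw [uIoc_of_le hT] at hr'
          exact hbound j _ (hr hr'))
      refine h1.trans (mul_le_mul_of_nonneg_left ?_ C.2)
      rw [sub_zero, abs_of_nonneg hT]
      exact_mod_cast outsideHit_le H ω
    · rw [show 𝓝 (0 : ℝ) = 𝓝 (∫ r in (0 : ℝ)..outsideHit D H ω, (0 : ℝ)) by simp]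
      refine intervalIntegral.tendsto_integral_filter_of_dominated_convergence (fun _ => (C : ℝ))
        (Eventually.of_forall fun j => ?_) (Eventually.of_forall fun j => ?_)
        intervalIntegrable_const ?_
      · rw [uIoc_of_le hT]
        exact (hω j (outsideHit D H ω)).1.aestronglyMeasurable
      · filter_upwards [hmem] with r hr hr'
        rw [uIoc_of_le hT] at hr'
        exact hbound j _ (hr hr')
      · filter_upwards [hmem] with r hr hr'
        rw [uIoc_of_le hT] at hr'
        exact hlim0 _ (hr hr')
  have hXmeas := measurable_X_outsideHit (D := D) hD H
  have hfint : ∀ j, Integrable (fun ω => f j (X (outsideHit D H ω) ω)) P := fun j =>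
    Integrable.of_bound ((hfC j).1.continuous.measurable.comp hXmeas).aestronglyMeasurable 1
      (Eventually.of_forall fun ω => by
        rw [Real.norm_of_nonneg (hf0 j _)]
        exact hf1 j _)
  have hdynkin : ∀ j, ∀ᵐ ω ∂P, ∫ r in (0 : ℝ)..outsideHit D H ω, A.apply (f j) (X r.toNNReal ω) =
      f j (X (outsideHit D H ω) ω) - mgProcess A (f j) (outsideHit D H ω) ω := fun j => by
    filter_upwards [ae_X_zero_eq hP] with ω hω
    simp only [mgProcess]
    rw [hω, hfD j x (hcl x hx)]
    ring
  have hmg := fun j => integral_mgProcess_outsideHit hD hP (hfC j) H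
  have hexp : ∀ j, ∫ ω, f j (X (outsideHit D H ω) ω) ∂P =
      ∫ ω, (∫ r in (0 : ℝ)..outsideHit D H ω, A.apply (f j) (X r.toNNReal ω)) ∂P := fun j => by
    rw [integral_congr_ae (hdynkin j), integral_sub (hfint j) (hmg j).1, (hmg j).2, sub_zero]
  have hlim : Tendsto (fun j => ∫ ω, f j (X (outsideHit D H ω) ω) ∂P) atTop (𝓝 0) := by
    simp only [hexp]
    rw [show 𝓝 (0 : ℝ) = 𝓝 (∫ _ : CadlagPath d, (0 : ℝ) ∂P) by simp]
    refine tendsto_integral_of_dominated_convergence (fun _ => (C * H : ℝ)) (fun j => ?_)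
      (integrable_const _) (fun j => ?_) ?_
    · exact ((hfint j).1.sub (hmg j).1.1).congr
        ((hdynkin j).mono fun ω h => h.symm)
    · filter_upwards [hcomp] with ω hω using hω.1 j
    · filter_upwards [hcomp] with ω hω using hω.2
  have hKm : MeasurableSet {ω | X (outsideHit D H ω) ω ∈ K} := hXmeas hK.measurableSet
  have hle : ∀ j, P.real {ω | X (outsideHit D H ω) ω ∈ K} ≤
      ∫ ω, f j (X (outsideHit D H ω) ω) ∂P := fun j => by
    rw [← integral_indicator_one hKm]
    refine integral_mono ((integrable_const 1).indicator hKm) (hfint j) fun ω => ?_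
    by_cases hω : ω ∈ {ω | X (outsideHit D H ω) ω ∈ K}
    · rw [indicator_of_mem hω]
      exact (hfK j _ hω).ge
    · rw [indicator_of_notMem hω]
      exact hf0 j _
  have hz : P.real {ω | X (outsideHit D H ω) ω ∈ K} ≤ 0 := ge_of_tendsto' hlim hle
  exact (measureReal_eq_zero_iff).1 (le_antisymm hz measureReal_nonneg)

/-- Almost surely, the process does not leave `D` by a jump into a Borel subset `B` of the exterior
of `D` which the Lévy kernel does not charge from `D`. -/
theorem ae_X_exitTime_notMem (hD : MeasurableSet D) {A : LevyOperator d D} {x : E d}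
    (hx : x ∈ D) {P : Measure (CadlagPath d)}
    (hP : SolvesMartingaleProblem A (Measure.dirac x) P) {B : Set (E d)} (hB : MeasurableSet B)
    (hBD : Disjoint B (closure D)) (hN : ∀ z ∈ D, A.N z {y | z + y ∈ B} = 0) :
    ∀ᵐ ω ∂P, ∀ τ : ℝ≥0, exitTime D ω = τ → X τ ω ∉ B := by
  have := hP.isProb
  have hH : ∀ n : ℕ, ∀ᵐ ω ∂P, X (outsideHit D n ω) ω ∉ B := fun n => by
    have hXmeas := measurable_X_outsideHit (D := D) hD n
    refine (measure_eq_zero_iff_ae_notMem (s := {ω | X (outsideHit D n ω) ω ∈ B})).1 ?_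
    have : IsProbabilityMeasure (P.map fun ω => X (outsideHit D n ω) ω) :=
      Measure.isProbabilityMeasure_map hXmeas.aemeasurable
    have hmap : P.map (fun ω => X (outsideHit D n ω) ω) B = 0 := by
      rw [hB.measure_eq_iSup_isCompact]
      refine le_antisymm (iSup_le fun K => iSup_le fun hKB => iSup_le fun hK => ?_) zero_le
      rw [Measure.map_apply hXmeas hK.measurableSet]
      exact (measure_X_outsideHit_mem_compact hD hx hP hK (hBD.mono_left hKB)
        (fun z hz => measure_mono_null (fun y hy => @hKB (z + y) hy) (hN z hz)) n).le
    rwa [Measure.map_apply hXmeas hB] at hmap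
  filter_upwards [ae_all_iff.2 hH] with ω hω τ hτ hmem
  obtain ⟨n, hn⟩ := exists_nat_gt τ
  have h := hω n
  rw [outsideHit_eq_exitTime hτ hn (disjoint_left.1 hBD hmem)] at h
  exact h hmem

/-! ### Exit through the extended boundary -/

theorem le_supOn {f : E d → ℝ} {B : Set (E d)} {C : ℝ} (hC : ∀ z ∈ B, f z ≤ C) {z : E d}
    (hz : z ∈ B) : f z ≤ supOn f B :=
  le_csSup ⟨C, by rintro _ ⟨w, hw, rfl⟩; exact hC w hw⟩ ⟨z, hz, rfl⟩

theorem infOn_le {f : E d → ℝ} {B : Set (E d)} {C : ℝ} (hC : ∀ z ∈ B, C ≤ f z) {z : E d}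
    (hz : z ∈ B) : infOn f B ≤ f z :=
  csInf_le ⟨C, by rintro _ ⟨w, hw, rfl⟩; exact hC w hw⟩ ⟨z, hz, rfl⟩

theorem coe_exitMin (t : ℝ≥0) (ω : CadlagPath d) :
    (exitMin D t ω : ℝ≥0∞) = min (exitTime D ω) t :=
  ENNReal.coe_toNNReal (ne_top_of_le_ne_top ENNReal.coe_ne_top (min_le_right _ _))

/-- The process stopped at the exit from `D` stays in `D_S`, as far as the values of a bounded
Borel function can tell. (The set `D_S` itself need not be Borel.) -/
theorem ae_le_supOn_extDomain (hD : IsOpen D) {A : LevyOperator d D} {x : E d} (hx : x ∈ D)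
    {P : Measure (CadlagPath d)} (hP : SolvesMartingaleProblem A (Measure.dirac x) P)
    {u : E d → ℝ} (hu : Measurable u) {C : ℝ} (hC : ∀ z, u z ≤ C) (t : ℝ≥0) :
    ∀ᵐ ω ∂P, u (X (exitMin D t ω) ω) ≤ supOn u A.extDomain := by
  have hsup : ∀ z ∈ A.extDomain, u z ≤ supOn u A.extDomain :=
    fun z hz => le_supOn (fun w _ => hC w) hz
  have hsupD : ∀ z ∈ D, u z ≤ supOn u A.extDomain := fun z hz => hsup z (Or.inr hz)
  set B : Set (E d) := {z | supOn u A.extDomain < u z} \ closure D with hBdef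
  have hB : MeasurableSet B := (hu measurableSet_Ioi).diff isClosed_closure.measurableSet
  have hN : ∀ z ∈ D, A.N z {y | z + y ∈ B} = 0 := fun z hz => by
    refine measure_mono_null (t := (A.N z).supportᶜ) (fun y hy hys => ?_)
      (Measure.measure_compl_support (μ := A.N z))
    have hmem : z + y ∈ A.nonlocalRange := mem_iUnion₂.2 ⟨z, hz, y, hys, rfl⟩
    refine (show supOn u A.extDomain < u (z + y) from hy.1).not_ge ?_
    by_cases hzD : z + y ∈ D
    · exact hsupD _ hzD
    · exact hsup _ (Or.inl (Or.inr ⟨hmem, hzD⟩))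
  filter_upwards [ae_X_zero_eq hP,
    ae_X_exitTime_notMem hD.measurableSet hx hP hB disjoint_sdiff_left hN] with ω h0 hω
  rcases lt_or_ge (t : ℝ≥0∞) (exitTime D ω) with h | h
  · have hS : exitMin D t ω = t := by
      have := coe_exitMin (D := D) t ω
      rw [min_eq_right h.le] at this
      exact_mod_cast this
    rw [hS]
    rcases eq_or_ne t 0 with rfl | ht
    · rw [h0]
      exact hsupD x hx
    · exact hsupD _ (mem_of_lt_exitTime (pos_iff_ne_zero.2 ht) h)
  · have hS : exitTime D ω = exitMin D t ω := by
      rw [coe_exitMin, min_eq_left h]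
    have hnot := X_exitTime_notMem hD hS
    by_cases hcl : X (exitMin D t ω) ω ∈ closure D
    · refine hsup _ (Or.inl (Or.inl ⟨hcl, ?_⟩))
      rwa [hD.interior_eq]
    · by_contra hlt
      exact hω _ hS ⟨not_le.1 hlt, hcl⟩

/-! ### Bounds along the path before the exit -/

theorem mem_of_lt_exitMin {t : ℝ≥0} {ω : CadlagPath d} {r : ℝ} (h0 : 0 < r)
    (h : r < exitMin D t ω) : X r.toNNReal ω ∈ D := by
  refine mem_of_lt_exitTime (Real.toNNReal_pos.2 h0) ?_
  have h1 : r.toNNReal < exitMin D t ω := (Real.toNNReal_lt_iff_lt_coe h0.le).2 h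
  have h2 : (r.toNNReal : ℝ≥0∞) < exitMin D t ω := by exact_mod_cast h1
  rw [coe_exitMin] at h2
  exact h2.trans_le (min_le_left _ _)

/-- Before the exit from `D`, the integral of `c` along the path is controlled by the bounds of
`c` in `D`. -/
theorem integral_path_mem_Icc {c : E d → ℝ} (hc : Measurable c) {a b : ℝ}
    (hab : ∀ z ∈ D, c z ∈ Icc a b) {t q : ℝ≥0} {ω : CadlagPath d} (hq : q ≤ exitMin D t ω) :
    ∫ r in (0 : ℝ)..q, c (X r.toNNReal ω) ∈ Icc (a * q) (b * q) := by
  have hq0 : (0 : ℝ) ≤ q := q.2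
  have hmem : ∀ r ∈ Ioo (0 : ℝ) q, c (X r.toNNReal ω) ∈ Icc a b := fun r hr =>
    hab _ (mem_of_lt_exitMin hr.1 (hr.2.trans_le (by exact_mod_cast hq)))
  have hint : IntervalIntegrable (fun r : ℝ => c (X r.toNNReal ω)) volume 0 q := by
    rw [intervalIntegrable_iff_integrableOn_Ioo_of_le hq0]
    refine Measure.integrableOn_of_bounded (M := max |a| |b|) (by simp)
      (hc.comp (measurable_path ω)).aestronglyMeasurable ?_
    filter_upwards [ae_restrict_mem measurableSet_Ioo] with r hr
    exact abs_le_max_abs_abs (hmem r hr).1 (hmem r hr).2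
  constructor
  · have := intervalIntegral.integral_mono_on_of_le_Ioo hq0 intervalIntegrable_const hint
      fun r hr => (hmem r hr).1
    rw [intervalIntegral.integral_const] at this
    simpa [mul_comm] using this
  · have := intervalIntegral.integral_mono_on_of_le_Ioo hq0 hint intervalIntegrable_const
      fun r hr => (hmem r hr).2
    rw [intervalIntegral.integral_const] at this
    simpa [mul_comm] using this

/-- On `{s < τ_D}`, the source accumulated up to `τ_D ∧ t` is at least what the bounds of `c`
and `g` in `D` guarantee during `(0, s)`. -/
theorem le_lintegral_source {c g : E d → ℝ} (hc : Measurable c) {a b γ : ℝ}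
    (hab : ∀ z ∈ D, c z ∈ Icc a b) (hb : 0 ≤ b) (hγ : 0 ≤ γ) (hg : ∀ z ∈ D, γ ≤ -g z)
    {s t : ℝ≥0} {ω : CadlagPath d} (hs : s ≤ exitMin D t ω) :
    ENNReal.ofReal (Real.exp (-(b * s)) * γ * s) ≤
      ∫⁻ r in Ioc (0 : ℝ) (exitMin D t ω),
        ENNReal.ofReal (expFunctional c r.toNNReal ω * -g (X r.toNNReal ω)) := by
  have hsub : Ioo (0 : ℝ) s ⊆ Ioc 0 (exitMin D t ω) := fun r hr =>
    ⟨hr.1, hr.2.le.trans (by exact_mod_cast hs)⟩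
  refine le_trans ?_ (lintegral_mono_set hsub)
  calc ENNReal.ofReal (Real.exp (-(b * s)) * γ * s)
      = ∫⁻ _ in Ioo (0 : ℝ) s, ENNReal.ofReal (Real.exp (-(b * s)) * γ) := by
        rw [setLIntegral_const, Real.volume_Ioo, sub_zero, ENNReal.ofReal_mul (by positivity)]
    _ ≤ _ := by
      refine setLIntegral_mono' measurableSet_Ioo fun r hr => ENNReal.ofReal_le_ofReal ?_
      have hrS : r.toNNReal ≤ exitMin D t ω :=
        (Real.toNNReal_le_iff_le_coe.2 hr.2.le).trans hs
      have h1 := (integral_path_mem_Icc hc hab hrS).2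
      rw [Real.coe_toNNReal r hr.1.le] at h1
      have h2 : b * r ≤ b * s := mul_le_mul_of_nonneg_left hr.2.le hb
      refine mul_le_mul (Real.exp_le_exp.2 (neg_le_neg ?_))
        (hg _ (mem_of_lt_exitMin hr.1 (hsub hr |>.2.lt_of_ne ?_))) hγ (Real.exp_pos _).le
      · rw [Real.coe_toNNReal r hr.1.le]
        exact h1.trans h2
      · exact (hr.2.trans_le (by exact_mod_cast hs)).ne

/-! ### The eigenfunction and the tail of the exit time -/

section Eigen

variable {P : Kernel (E d) (CadlagPath d)} {m : Measure (E d)} {φ : E d → ℝ} {lam : ℝ}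

theorem IsNonnegEigenpair.le_sup (hφ : IsNonnegEigenpair P D m φ lam) {z : E d} (hz : z ∈ D) :
    φ z ≤ supOn (fun y => |φ y|) D := by
  obtain ⟨C, hC⟩ := hφ.bounded
  exact (le_abs_self _).trans (le_supOn (f := fun y => |φ y|) hC hz)

/-- The random variable `φ(X_s) 1_{s < τ_D}`, whose expectation defines the killed semigroup, is
integrable: the exit time is not assumed measurable, but the eigenfunction equation at a point where
`φ` does not vanish says that the expectation is not zero. -/
theorem IsNonnegEigenpair.integrable (hφ : IsNonnegEigenpair P D m φ lam) {x : E d} (hx : x ∈ D)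
    (hpos : 0 < φ x) (s : ℝ≥0) :
    Integrable ({ω | (s : ℝ≥0∞) < exitTime D ω}.indicator fun ω => φ (X s ω)) (P x) := by
  by_contra hni
  have h := hφ.eigen s x hx
  rw [killedSemigroup, integral_undef hni] at h
  exact (mul_pos (Real.exp_pos _) hpos).ne' h

theorem IsNonnegEigenpair.indicator_nonneg (hφ : IsNonnegEigenpair P D m φ lam) {s : ℝ≥0}
    (hs : 0 < s) (ω : CadlagPath d) :
    0 ≤ {ω | (s : ℝ≥0∞) < exitTime D ω}.indicator (fun ω => φ (X s ω)) ω :=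
  Set.indicator_nonneg (fun _ hω => hφ.nonneg _ (mem_of_lt_exitTime hs hω)) ω

theorem IsNonnegEigenpair.indicator_le (hφ : IsNonnegEigenpair P D m φ lam) {x : E d} (hx : x ∈ D)
    {s : ℝ≥0} (hs : 0 < s) (ω : CadlagPath d) :
    {ω | (s : ℝ≥0∞) < exitTime D ω}.indicator (fun ω => φ (X s ω)) ω ≤
      supOn (fun y => |φ y|) D := by
  by_cases h : (s : ℝ≥0∞) < exitTime D ω
  · rw [indicator_of_mem (show ω ∈ {ω | (s : ℝ≥0∞) < exitTime D ω} from h)]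
    exact hφ.le_sup (mem_of_lt_exitTime hs h)
  · rw [indicator_of_notMem (show ω ∉ {ω | (s : ℝ≥0∞) < exitTime D ω} from h)]
    exact (hφ.nonneg x hx).trans (hφ.le_sup hx)

/-- The eigenvalue is positive when the process exits `D` almost surely: otherwise `φ` would be the
limit of `E_x[φ(X_n), n < τ_D]`, which is zero. -/
theorem IsNonnegEigenpair.eigenvalue_pos [IsMarkovKernel P] (hφ : IsNonnegEigenpair P D m φ lam)
    {x : E d} (hx : x ∈ D) (hpos : 0 < φ x) (hexit : ∀ᵐ ω ∂(P x), exitTime D ω < ⊤) :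
    0 < lam := by
  refine hφ.eigenvalue_nonneg.lt_of_ne fun h0 => ?_
  have hconst : ∀ n : ℕ, killedSemigroup P D (n + 1 : ℝ≥0) φ x = φ x := fun n => by
    rw [← hφ.eigen _ x hx, ← h0]
    simp
  have hlim : Tendsto (fun n : ℕ => killedSemigroup P D (n + 1 : ℝ≥0) φ x) atTop
      (𝓝 (∫ _, (0 : ℝ) ∂(P x))) := by
    refine tendsto_integral_of_dominated_convergence (fun _ => supOn (fun y => |φ y|) D)
      (fun n => (hφ.integrable hx hpos _).1) (integrable_const _)
      (fun n => Eventually.of_forall fun ω => ?_) ?_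
    · rw [Real.norm_of_nonneg (hφ.indicator_nonneg (by positivity) ω)]
      exact hφ.indicator_le hx (by positivity) ω
    · filter_upwards [hexit] with ω hω
      obtain ⟨N, hN⟩ := ENNReal.exists_nat_gt hω.ne
      refine tendsto_const_nhds.congr' ?_
      filter_upwards [eventually_ge_atTop N] with n hn
      refine (indicator_of_notMem (fun hmem => ?_) _).symm
      refine (show ((n + 1 : ℝ≥0) : ℝ≥0∞) < exitTime D ω from hmem).not_ge (hN.le.trans ?_)
      have : (N : ℝ≥0) ≤ n + 1 := by exact_mod_cast hn.trans n.le_succ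
      exact_mod_cast this
  simp only [hconst, integral_zero] at hlim
  exact hpos.ne' (tendsto_nhds_unique tendsto_const_nhds hlim)

end Eigen

/-! ### The two contributions to the Hopf lower bound -/

theorem half_le_one_sub_exp_neg {v : ℝ} (h0 : 0 ≤ v) (h1 : v ≤ 1) :
    v / 2 ≤ 1 - Real.exp (-v) := by
  have h2 : (1 + v) * Real.exp (-v) ≤ 1 := by
    have := mul_le_mul_of_nonneg_right (Real.add_one_le_exp v) (Real.exp_pos (-v)).le
    rw [← Real.exp_add, add_neg_cancel, Real.exp_zero] at this
    linarith
  nlinarith [Real.exp_pos (-v)]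

section Subsolution

variable {A : LevyOperator d D} {P : Kernel (E d) (CadlagPath d)} {m : Measure (E d)}
  {φ : E d → ℝ} {lam : ℝ} {c : E d → ℝ} {a b : ℝ} {x : E d} {s t : ℝ≥0}

theorem le_exitMin {ω : CadlagPath d} (hst : s ≤ t) (h : (s : ℝ≥0∞) < exitTime D ω) :
    s ≤ exitMin D t ω := by
  have : (s : ℝ≥0∞) ≤ exitMin D t ω := by
    rw [coe_exitMin]
    exact le_min h.le (by exact_mod_cast hst)
  exact_mod_cast this

/-- Discounting by `c ≥ a` costs at least the factor `1 - e^{-a s}` on `{s < τ_D}`, and the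
probability of that event is at least `e^{-λ s} φ(x) / ‖φ‖`. -/
theorem integral_discounted_le (hD : IsOpen D) (hx : x ∈ D)
    (hP : SolvesMartingaleProblem A (Measure.dirac x) (P x))
    (hφ : IsNonnegEigenpair P D m φ lam) (hpos : 0 < φ x)
    (hc : Measurable c) (ha : 0 ≤ a) (hab : ∀ z ∈ D, c z ∈ Icc a b)
    {u : E d → ℝ} (hu : Measurable u) {C : ℝ} (hC : ∀ z, u z ≤ C)
    (hM : 0 ≤ supOn u A.extDomain) (hs : 0 < s) (hst : s ≤ t) :
    ∫ ω, expFunctional c (exitMin D t ω) ω * u (X (exitMin D t ω) ω) ∂(P x) ≤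
      supOn u A.extDomain * (1 - (1 - Real.exp (-(a * s))) *
        (Real.exp (-lam * s) * φ x / supOn (fun y => |φ y|) D)) := by
  have := hP.isProb
  set M := supOn u A.extDomain
  set Φ := supOn (fun y => |φ y|) D
  set k := Real.exp (-(a * s))
  set G : CadlagPath d → ℝ := {ω | (s : ℝ≥0∞) < exitTime D ω}.indicator fun ω => φ (X s ω)
  have hΦ : 0 < Φ := hpos.trans_le (hφ.le_sup hx)
  have hk0 : 0 < k := Real.exp_pos _
  have hk1 : k ≤ 1 := Real.exp_le_one_iff.2 (neg_nonpos.2 (by positivity))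
  have hG : Integrable G (P x) := hφ.integrable hx hpos s
  have hG0 : ∀ ω, 0 ≤ G ω / Φ := fun ω => div_nonneg (hφ.indicator_nonneg hs ω) hΦ.le
  have hG1 : ∀ ω, G ω / Φ ≤ 1 := fun ω => (div_le_one hΦ).2 (hφ.indicator_le hx hs ω)
  have hGint : ∫ ω, G ω ∂(P x) = Real.exp (-lam * s) * φ x := (hφ.eigen s x hx).symm
  have hR : Integrable (fun ω => M * (1 - (1 - k) * (G ω / Φ))) (P x) :=
    ((integrable_const _).sub ((hG.div_const Φ).const_mul _)).const_mul _
  have hRint : ∫ ω, M * (1 - (1 - k) * (G ω / Φ)) ∂(P x) =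
      M * (1 - (1 - k) * (Real.exp (-lam * s) * φ x / Φ)) := by
    rw [integral_const_mul, integral_sub (integrable_const _) ((hG.div_const Φ).const_mul _),
      integral_const_mul, integral_div, hGint]
    simp
  have hR0 : ∀ ω, 0 ≤ M * (1 - (1 - k) * (G ω / Φ)) := fun ω =>
    mul_nonneg hM (by nlinarith [hG0 ω, hG1 ω])
  rw [← hRint]
  -- a non-integrable integrand has integral zero, and the right-hand side is non-negative
  by_cases hF : Integrable (fun ω => expFunctional c (exitMin D t ω) ω *
    u (X (exitMin D t ω) ω)) (P x)
  swap
  · rw [integral_undef hF]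
    exact integral_nonneg hR0
  refine integral_mono_ae hF hR ?_
  filter_upwards [ae_le_supOn_extDomain hD hx hP hu hC t] with ω hω
  have he : expFunctional c (exitMin D t ω) ω ≤ Real.exp (-(a * exitMin D t ω)) :=
    Real.exp_le_exp.2 (neg_le_neg (integral_path_mem_Icc hc hab le_rfl).1)
  refine (mul_le_mul_of_nonneg_left hω (Real.exp_pos _).le).trans ?_
  rw [mul_comm]
  refine mul_le_mul_of_nonneg_left (he.trans ?_) hM
  by_cases h : (s : ℝ≥0∞) < exitTime D ω
  · have h1 : Real.exp (-(a * exitMin D t ω)) ≤ k :=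
      Real.exp_le_exp.2 (neg_le_neg (mul_le_mul_of_nonneg_left
        (by exact_mod_cast le_exitMin hst h) ha))
    nlinarith [hG0 ω, hG1 ω]
  · have hG' : G ω = 0 := indicator_of_notMem (s := {ω | (s : ℝ≥0∞) < exitTime D ω}) h _
    rw [hG', zero_div, mul_zero, sub_zero]
    exact Real.exp_le_one_iff.2 (neg_nonpos.2 (by positivity))

/-- The source accumulated on `{s < τ_D}` is bounded below by `le_lintegral_source`, and the
probability of that event is at least `e^{-λ s} φ(x) / ‖φ‖`. -/
theorem le_toReal_sourceTerm (hx : x ∈ D) (hφ : IsNonnegEigenpair P D m φ lam) (hpos : 0 < φ x)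
    (hc : Measurable c) (hab : ∀ z ∈ D, c z ∈ Icc a b) (hb : 0 ≤ b)
    {g : E d → ℝ} {γ : ℝ} (hγ : 0 ≤ γ) (hg : ∀ z ∈ D, γ ≤ -g z)
    (hfin : sourceTerm P D c g t x ≠ ⊤) (hs : 0 < s) (hst : s ≤ t) :
    Real.exp (-(b * s)) * γ * s * (Real.exp (-lam * s) * φ x / supOn (fun y => |φ y|) D) ≤
      (sourceTerm P D c g t x).toReal := by
  set Φ := supOn (fun y => |φ y|) D
  set κ := Real.exp (-(b * s)) * γ * s
  set G : CadlagPath d → ℝ := {ω | (s : ℝ≥0∞) < exitTime D ω}.indicator fun ω => φ (X s ω)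
  have hΦ : 0 < Φ := hpos.trans_le (hφ.le_sup hx)
  have hκ : 0 ≤ κ := by positivity
  have hG : Integrable G (P x) := hφ.integrable hx hpos s
  have hG0 : ∀ ω, 0 ≤ G ω / Φ := fun ω => div_nonneg (hφ.indicator_nonneg hs ω) hΦ.le
  have hG1 : ∀ ω, G ω / Φ ≤ 1 := fun ω => (div_le_one hΦ).2 (hφ.indicator_le hx hs ω)
  have hint : ∫ ω, κ * (G ω / Φ) ∂(P x) = κ * (Real.exp (-lam * s) * φ x / Φ) := by
    rw [integral_const_mul, integral_div, hφ.eigen s x hx, killedSemigroup]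
  rw [← ENNReal.ofReal_le_iff_le_toReal hfin, ← hint,
    ofReal_integral_eq_lintegral_ofReal ((hG.div_const Φ).const_mul κ)
      (Eventually.of_forall fun ω => mul_nonneg hκ (hG0 ω))]
  refine lintegral_mono fun ω => ?_
  by_cases h : (s : ℝ≥0∞) < exitTime D ω
  · refine le_trans (ENNReal.ofReal_le_ofReal ?_)
      (le_lintegral_source hc hab hb hγ hg (le_exitMin hst h))
    exact mul_le_of_le_one_right hκ (hG1 ω)
  · have hG' : G ω = 0 := indicator_of_notMem (s := {ω | (s : ℝ≥0∞) < exitTime D ω}) h _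
    simp [hG']

end Subsolution

end LevyHopf

/-! ### The Hopf lemma -/

theorem theorem3p12 {d : ℕ} {D : Set (E d)} (hDopen : IsOpen D) (hDconn : IsConnected D)
    -- the operator `A` with coefficients `(Q, b, N)`
    (A : LevyOperator d D)
    -- the zero-order coefficient `c` and the right-hand side `g`, Borel functions on `D`
    -- (extended to `ℝᵈ`; their values outside `D` play no role)
    (c : E d → ℝ) (hcmeas : Measurable c) (hcnonneg : ∀ x ∈ D, 0 ≤ c x)
    (hcbdd : ∃ C : ℝ, ∀ x ∈ D, c x ≤ C)
    (g : E d → ℝ) (hgmeas : Measurable g) (hgnonpos : ∀ x ∈ D, g x ≤ 0)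
    -- a strong Markovian solution of the martingale problem, exiting `D` almost surely
    (P : Kernel (E d) (CadlagPath d)) (hP : IsStrongMarkovSolution A P)
    (hET : ∀ x ∈ D, ∀ᵐ ω ∂(P x), exitTime D ω < ⊤)
    -- a non-negative eigenfunction and its eigenvalue
    (m : Measure (E d)) [SigmaFinite m] (φ : E d → ℝ) (lam : ℝ)
    (hφ : IsNonnegEigenpair P D m φ lam)
    -- a weak subsolution with non-negative supremum over `D_S`
    (u : E d → ℝ) (hu : IsWeakSubsolution P D c g u) (hupos : 0 ≤ supOn u A.extDomain) :
    ∀ x ∈ D, supOn u A.extDomain - u x ≥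
      φ x / (2 * Real.exp 1 * supOn (fun y => |φ y|) D) *
        (infOn c D * supOn u A.extDomain / (lam + infOn c D)
          + infOn (fun y => max (-g y) 0) D / (lam + supOn c D)) := by
  intro x hx
  have : IsMarkovKernel P := ⟨fun y => (hP.solves y).isProb⟩
  obtain ⟨Cu, hCu⟩ := hu.bounded
  have huC : ∀ z, u z ≤ Cu := fun z => (le_abs_self _).trans (hCu z)
  rcases (hφ.nonneg x hx).eq_or_lt with h0 | hpos
  · rw [← h0, zero_div, zero_mul, ge_iff_le, sub_nonneg]
    exact le_supOn (fun z _ => huC z) (Or.inr hx)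
  have hlam : 0 < lam := hφ.eigenvalue_pos hx hpos (hET x hx)
  obtain ⟨Cc, hCc⟩ := hcbdd
  set M := supOn u A.extDomain
  set Φ := supOn (fun y => |φ y|) D
  set a := infOn c D
  set b := supOn c D
  set γ := infOn (fun y => max (-g y) 0) D
  have hΦ : 0 < Φ := hpos.trans_le (hφ.le_sup hx)
  have hab : ∀ z ∈ D, c z ∈ Set.Icc a b := fun z hz => ⟨infOn_le hcnonneg hz, le_supOn hCc hz⟩
  have ha : 0 ≤ a := Real.sInf_nonneg (by rintro _ ⟨z, hz, rfl⟩; exact hcnonneg z hz)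
  have hb : 0 ≤ b := (hcnonneg x hx).trans (hab x hx).2
  have hγ : 0 ≤ γ := Real.sInf_nonneg (by rintro _ ⟨z, hz, rfl⟩; exact le_max_right _ _)
  have hg : ∀ z ∈ D, γ ≤ -g z := fun z hz =>
    (infOn_le (f := fun y => max (-g y) 0) (C := 0) (fun _ _ => le_max_right _ _) hz).trans
      (max_le le_rfl (neg_nonneg.2 (hgnonpos z hz)))
  -- the time `1 / (λ + a)` is used for the discount and `1 / (λ + b)` for the source
  have hla : 0 < lam + a := by positivity
  have hlb : 0 < lam + b := by positivity
  let s₁ : ℝ≥0 := ⟨1 / (lam + a), by positivity⟩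
  let s₂ : ℝ≥0 := ⟨1 / (lam + b), by positivity⟩
  have hs₁ : 0 < s₁ := show (0 : ℝ) < 1 / (lam + a) by positivity
  have hs₂ : 0 < s₂ := show (0 : ℝ) < 1 / (lam + b) by positivity
  obtain ⟨hfin, hle⟩ := hu.le x hx (max s₁ s₂)
  have h1 := integral_discounted_le hDopen hx (hP.solves x) hφ hpos hcmeas ha hab hu.measurable
    huC hupos hs₁ (le_max_left s₁ s₂)
  have h2 := le_toReal_sourceTerm hx hφ hpos hcmeas hab hb hγ hg hfin hs₂ (le_max_right s₁ s₂)
  have hs₁' : (s₁ : ℝ) = 1 / (lam + a) := rfl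
  have hs₂' : (s₂ : ℝ) = 1 / (lam + b) := rfl
  rw [hs₁'] at h1
  rw [hs₂'] at h2
  have hdisc : a / (lam + a) / 2 * Real.exp (-1) ≤
      (1 - Real.exp (-(a * (1 / (lam + a))))) * Real.exp (-lam * (1 / (lam + a))) := by
    rw [mul_one_div]
    have hv1 : a / (lam + a) ≤ 1 := (div_le_one hla).2 (by linarith)
    have hv0 : 0 ≤ a / (lam + a) := by positivity
    have hhalf := half_le_one_sub_exp_neg hv0 hv1
    refine mul_le_mul hhalf (Real.exp_le_exp.2 ?_) (Real.exp_pos _).le (by linarith)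
    rw [mul_one_div, neg_div, neg_le_neg_iff, div_le_one hla]
    linarith
  have hsource : γ / (lam + b) * Real.exp (-1) =
      Real.exp (-(b * (1 / (lam + b)))) * γ * (1 / (lam + b)) *
        Real.exp (-lam * (1 / (lam + b))) := by
    have he : Real.exp (-1) =
        Real.exp (-(b * (1 / (lam + b)))) * Real.exp (-lam * (1 / (lam + b))) := by
      rw [← Real.exp_add]
      congr 1
      field_simp
      ring
    rw [he]
    ring
  have hw : 0 ≤ φ x / Φ := by positivity
  have hdisc' := mul_le_mul_of_nonneg_left hdisc (mul_nonneg hupos hw)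
  have hsrc0 : 0 ≤ φ x / Φ * (γ / (lam + b) * Real.exp (-1)) := by positivity
  have hgoal : φ x / (2 * Real.exp 1 * Φ) * (a * M / (lam + a) + γ / (lam + b)) =
      M * (φ x / Φ) * (a / (lam + a) / 2 * Real.exp (-1)) +
        φ x / Φ * (γ / (lam + b) * Real.exp (-1)) / 2 := by
    rw [Real.exp_neg]
    field_simp
  have h1' : M * (1 - (1 - Real.exp (-(a * (1 / (lam + a))))) *
      (Real.exp (-lam * (1 / (lam + a))) * φ x / Φ)) = M - M * (φ x / Φ) *
      ((1 - Real.exp (-(a * (1 / (lam + a))))) * Real.exp (-lam * (1 / (lam + a)))) := by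
    ring
  have h2' : Real.exp (-(b * (1 / (lam + b)))) * γ * (1 / (lam + b)) *
      (Real.exp (-lam * (1 / (lam + b))) * φ x / Φ) =
      φ x / Φ * (γ / (lam + b) * Real.exp (-1)) := by
    rw [hsource]
    ring
  rw [ge_iff_le, hgoal]
  rw [h1'] at h1
  rw [h2'] at h2
  linarith
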